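/- Let $R$ be a commutative ring with unit, $I$ an ideal of $R$, $n\ge 3$, and let $\sigma$ be the permutation of $\{1,\dots,2n\}$ with $\sigma(2i)=2i-1$, $\sigma(2i-1)=2i$. For a commutative ring $S$, $z\in S$ and $1\le i\ne j\le 2n$ with $i\ne\sigma(j)$ put $$oe_{ij}(z)=1_{2n}+z\,e_{ij}-z\,e_{\sigma(j)\sigma(i)}\in \mathrm{GL}_{2n}(S).$$ Let $\mathrm{EO}_{2n}(S)$ be the subgroup of $\mathrm{GL}_{2n}(S)$ generated by all $oe_{ij}(z)$ with $z\in S$ (it lies in the orthogonal group of $\sum_{i=1}^n (e_{2i-1,2i}+e_{2i,2i-1})$). For an ideal $J$ of $S$ let $\mathrm{EO}_{2n}(J)$ be the subgroup generated by the $oe_{ij}(x)$ with $x\in J$, and let $\mathrm{EO}_{2n}(S,J)$ be the normal closure of $\mathrm{EO}_{2n}(J)$ in $\mathrm{EO}_{2n}(S)$. Let $a\in R$ be non-nilpotent, let $R_a$ be the localisation of $R$ at $\{a^k : k\ge 0\}$, let $I_a$ be the ideal of $R_a$ generated by the image of $I$, and let $I[X]\subseteq R[X]$, $I_a[X]\subseteq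 R_a[X]$ be the ideals of polynomials with coefficients in $I$, respectively $I_a$. Let $\alpha(X)\in \mathrm{EO}_{2n}(R_a[X],I_a[X])$ with $\alpha(0)=\mathrm{Id}$. Then there is an integer $d_0\ge 0$ such that for every $d\ge d_0$ and every $b$ in the principal ideal $(a^d)$ of $R$ there exists $\alpha^*(X)\in \mathrm{EO}_{2n}(R[X],I[X])$ with $\alpha^*(0)=\mathrm{Id}$ whose image in $\mathrm{GL}_{2n}(R_a[X])$ under the map induced by $R\to R_a$ equals $\alpha(bX)$. -/

import Mathlib

namespace RelOrthogonal

open Matrix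

/-- The involution `σ` of the index set of a `2n × 2n` matrix which swaps the members of each pair
of consecutive indices. Written with indices `1, …, 2n` it is `σ (2i) = 2i - 1`,
`σ (2i - 1) = 2i`; here the indices are `0, …, 2n - 1`, so the pairs are `(0, 1), (2, 3), …`. -/
def sigma {n : ℕ} (i : Fin (2 * n)) : Fin (2 * n) :=
  ⟨if i.1 % 2 = 0 then i.1 + 1 else i.1 - 1, by split <;> omega⟩

theorem sigma_sigma {n : ℕ} (i : Fin (2 * n)) : sigma (sigma i) = i := by
  ext
  simp only [sigma]
  split_ifs <;> omega

theorem sigma_ne {n : ℕ} (i : Fin (2 * n)) : sigma i ≠ i := by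
  intro h
  have := congrArg Fin.val h
  simp only [sigma] at this
  split_ifs at this <;> omega

/-- The standard symmetric matrix `ψ̃ₙ = ∑ᵢ e_{2i-1,2i} + ∑ᵢ e_{2i,2i-1}`: its `(i, j)` entry is `1`
if `j = σ i`, and `0` otherwise. -/
def psi (n : ℕ) (R : Type*) [CommRing R] : Matrix (Fin (2 * n)) (Fin (2 * n)) R :=
  Matrix.of fun i j => if j = sigma i then 1 else 0

/-- The orthogonal group `O_{2n}(R)` of all `α ∈ GL_{2n}(R)` with `αᵗ ψ̃ₙ α = ψ̃ₙ`. -/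
def orthogonal (n : ℕ) (R : Type*) [CommRing R] : Subgroup (GL (Fin (2 * n)) R) where
  carrier := {α | (α : Matrix (Fin (2 * n)) (Fin (2 * n)) R)ᵀ * psi n R *
    (α : Matrix (Fin (2 * n)) (Fin (2 * n)) R) = psi n R}
  one_mem' := by simp
  mul_mem' := by
    intro α β hα hβ
    simp only [Set.mem_ofPred_eq, Units.val_mul, Matrix.transpose_mul] at *
    calc _ = (β : Matrix (Fin (2 * n)) (Fin (2 * n)) R)ᵀ *
          ((α : Matrix (Fin (2 * n)) (Fin (2 * n)) R)ᵀ * psi n R *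
            (α : Matrix (Fin (2 * n)) (Fin (2 * n)) R)) *
          (β : Matrix (Fin (2 * n)) (Fin (2 * n)) R) := by simp only [Matrix.mul_assoc]
      _ = _ := by rw [hα, hβ]
  inv_mem' := by
    intro α hα
    simp only [Set.mem_ofPred_eq] at *
    have h1 : (α : Matrix (Fin (2 * n)) (Fin (2 * n)) R) *
        ((α⁻¹ : GL (Fin (2 * n)) R) : Matrix (Fin (2 * n)) (Fin (2 * n)) R) = 1 := by
      rw [← Units.val_mul, mul_inv_cancel, Units.val_one]
    have h2 : ((α⁻¹ : GL (Fin (2 * n)) R) : Matrix (Fin (2 * n)) (Fin (2 * n)) R)ᵀ *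
        (α : Matrix (Fin (2 * n)) (Fin (2 * n)) R)ᵀ = 1 := by
      rw [← Matrix.transpose_mul, h1, Matrix.transpose_one]
    calc _ = ((α⁻¹ : GL (Fin (2 * n)) R) : Matrix (Fin (2 * n)) (Fin (2 * n)) R)ᵀ *
          ((α : Matrix (Fin (2 * n)) (Fin (2 * n)) R)ᵀ * psi n R *
            (α : Matrix (Fin (2 * n)) (Fin (2 * n)) R)) *
          ((α⁻¹ : GL (Fin (2 * n)) R) : Matrix (Fin (2 * n)) (Fin (2 * n)) R) := by rw [hα]
      _ = (((α⁻¹ : GL (Fin (2 * n)) R) : Matrix (Fin (2 * n)) (Fin (2 * n)) R)ᵀ *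
          (α : Matrix (Fin (2 * n)) (Fin (2 * n)) R)ᵀ) * psi n R *
          ((α : Matrix (Fin (2 * n)) (Fin (2 * n)) R) *
          ((α⁻¹ : GL (Fin (2 * n)) R) : Matrix (Fin (2 * n)) (Fin (2 * n)) R)) := by
            simp only [Matrix.mul_assoc]
      _ = psi n R := by rw [h1, h2, Matrix.one_mul, Matrix.mul_one]

/-- The matrix `1 + z e_{ij} - z e_{σ(j) σ(i)}`. -/
def oeMatrix {n : ℕ} {R : Type*} [CommRing R] (i j : Fin (2 * n)) (z : R) :
    Matrix (Fin (2 * n)) (Fin (2 * n)) R :=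
  1 + Matrix.single i j z - Matrix.single (sigma j) (sigma i) z

theorem oeMatrix_mul {n : ℕ} {R : Type*} [CommRing R] {i j : Fin (2 * n)} (hij : i ≠ j)
    (hσ : i ≠ sigma j) (z w : R) :
    oeMatrix i j z * oeMatrix i j w = oeMatrix i j (z + w) := by
  have hσ' : j ≠ sigma i := fun h => hσ (by rw [h, sigma_sigma])
  have hij' : sigma i ≠ sigma j := fun h => hij (by rw [← sigma_sigma i, h, sigma_sigma])
  have e1 : Matrix.single i j z * Matrix.single i j w = 0 :=
    Matrix.single_mul_single_of_ne _ _ _ _ hij.symm _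
  have e2 : Matrix.single i j z * Matrix.single (sigma j) (sigma i) w = 0 :=
    Matrix.single_mul_single_of_ne _ _ _ _ (sigma_ne j).symm _
  have e3 : Matrix.single (sigma j) (sigma i) z * Matrix.single i j w = 0 :=
    Matrix.single_mul_single_of_ne _ _ _ _ (sigma_ne i) _
  have e4 : Matrix.single (sigma j) (sigma i) z * Matrix.single (sigma j) (sigma i) w = 0 :=
    Matrix.single_mul_single_of_ne _ _ _ _ hij' _
  simp only [oeMatrix, Matrix.single_add, mul_add, add_mul, mul_sub, sub_mul, e1, e2, e3, e4,
    one_mul, mul_one]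
  abel

theorem oeMatrix_zero {n : ℕ} {R : Type*} [CommRing R] (i j : Fin (2 * n)) :
    oeMatrix i j (0 : R) = 1 := by
  simp [oeMatrix]

/-- The elementary orthogonal matrix `oe_{ij}(z) = 1 + z e_{ij} - z e_{σ(j) σ(i)}`, for `i ≠ j` and
`i ≠ σ(j)`, as an invertible matrix. -/
def oe {n : ℕ} {R : Type*} [CommRing R] (i j : Fin (2 * n)) (hij : i ≠ j) (hσ : i ≠ sigma j)
    (z : R) : GL (Fin (2 * n)) R where
  val := oeMatrix i j z
  inv := oeMatrix i j (-z)
  val_inv := by rw [oeMatrix_mul hij hσ, add_neg_cancel, oeMatrix_zero]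
  inv_val := by rw [oeMatrix_mul hij hσ, neg_add_cancel, oeMatrix_zero]

/-- The group `EO_{2n}(I)` generated by the elementary orthogonal matrices `oe_{ij}(x)` with
`x ∈ I`. -/
def EOIdeal (n : ℕ) {R : Type*} [CommRing R] (I : Ideal R) : Subgroup (GL (Fin (2 * n)) R) :=
  Subgroup.closure {g | ∃ (i j : Fin (2 * n)) (hij : i ≠ j) (hσ : i ≠ sigma j),
    ∃ x ∈ I, g = oe i j hij hσ x}

/-- The elementary orthogonal group `EO_{2n}(R)` generated by all elementary orthogonal
matrices. -/
def EO (n : ℕ) (R : Type*) [CommRing R] : Subgroup (GL (Fin (2 * n)) R) :=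
  Subgroup.closure {g | ∃ (i j : Fin (2 * n)) (hij : i ≠ j) (hσ : i ≠ sigma j),
    ∃ z : R, g = oe i j hij hσ z}

/-- The relative elementary orthogonal group `EO_{2n}(R, I)`: the normal closure of `EO_{2n}(I)` in
`EO_{2n}(R)` (formed inside the group `EO_{2n}(R)`, then regarded as a subgroup of `GL_{2n}(R)`). -/
def relEO (n : ℕ) {R : Type*} [CommRing R] (I : Ideal R) : Subgroup (GL (Fin (2 * n)) R) :=
  (Subgroup.normalClosure
    (((EOIdeal n I).subgroupOf (EO n R) : Subgroup (EO n R)) : Set (EO n R))).map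
      (EO n R).subtype

theorem EOIdeal_le_EO (n : ℕ) {R : Type*} [CommRing R] (I : Ideal R) :
    EOIdeal n I ≤ EO n R :=
  Subgroup.closure_mono fun _ ⟨i, j, hij, hσ, x, _, hg⟩ => ⟨i, j, hij, hσ, x, hg⟩

theorem oe_mem_orthogonal {n : ℕ} {R : Type*} [CommRing R] {i j : Fin (2 * n)} (hij : i ≠ j)
    (hσ : i ≠ sigma j) (z : R) : oe i j hij hσ z ∈ orthogonal n R := by
  have hl (p q : Fin (2 * n)) (x : R) :
      Matrix.single p q x * psi n R = Matrix.single p (sigma q) x := by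
    ext k l
    by_cases hk : k = p
    · subst hk
      simp only [Matrix.single_mul_apply_same, psi, Matrix.of_apply, Matrix.single_apply]
      by_cases h : l = sigma q <;> simp [h, eq_comm]
    · rw [Matrix.single_mul_apply_of_ne _ _ _ _ _ hk, Matrix.single_apply_of_row_ne (Ne.symm hk)]
  have hr (p q : Fin (2 * n)) (x : R) :
      psi n R * Matrix.single p q x = Matrix.single (sigma p) q x := by
    ext k l
    by_cases hl : l = q
    · subst hl
      simp only [Matrix.mul_single_apply_same, psi, Matrix.of_apply, Matrix.single_apply]
      by_cases h : p = sigma k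
      · simp [h, sigma_sigma]
      · have h' : ¬ sigma p = k := fun e => h (by rw [← e, sigma_sigma])
        simp [h, h']
    · rw [Matrix.mul_single_apply_of_ne _ _ _ _ _ hl, Matrix.single_apply_of_col_ne _ _ (Ne.symm hl)]
  have hT : (oeMatrix i j z)ᵀ = oeMatrix j i z := by
    simp [oeMatrix, Matrix.transpose_sub, Matrix.transpose_add, Matrix.transpose_single]
  have hneg (p q : Fin (2 * n)) : Matrix.single p q (-z) = -Matrix.single p q z := by
    ext k l
    by_cases h : p = k ∧ q = l <;> simp [h]
  have key : oeMatrix j i z * psi n R = psi n R * oeMatrix i j (-z) := by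
    simp only [oeMatrix, sub_mul, add_mul, mul_sub, mul_add, one_mul, mul_one, hl, hr,
      sigma_sigma, hneg, mul_neg]
    abel
  change (oeMatrix i j z)ᵀ * psi n R * oeMatrix i j z = psi n R
  rw [hT, key, Matrix.mul_assoc, oeMatrix_mul hij hσ, neg_add_cancel, oeMatrix_zero,
    Matrix.mul_one]

/-- `EO_{2n}(R)` is a subgroup of `O_{2n}(R)`. -/
theorem EO_le_orthogonal (n : ℕ) (R : Type*) [CommRing R] : EO n R ≤ orthogonal n R := by
  refine (Subgroup.closure_le _).2 ?_
  rintro _ ⟨i, j, hij, hσ, z, rfl⟩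
  exact oe_mem_orthogonal hij hσ z

/-- The ideal `I[X]` of `R[X]` of polynomials with coefficients in `I`. -/
noncomputable def polyIdeal {R : Type*} [CommRing R] (I : Ideal R) : Ideal (Polynomial R) :=
  I.map (Polynomial.C : R →+* Polynomial R)

/-- The value `α(0)` of a matrix `α(X)` over `R[X]`. -/
noncomputable def evalZero {m : ℕ} {R : Type*} [CommRing R] :
    GL (Fin m) (Polynomial R) →* GL (Fin m) R :=
  Matrix.GeneralLinearGroup.map (Polynomial.evalRingHom (0 : R))

/-- The substitution `α(X) ↦ α(cX)` on matrices over `R[X]`. -/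
noncomputable def dilate {m : ℕ} {R : Type*} [CommRing R] (c : R) :
    GL (Fin m) (Polynomial R) →* GL (Fin m) (Polynomial R) :=
  Matrix.GeneralLinearGroup.map (Polynomial.compRingHom (Polynomial.C c * Polynomial.X))

/-- The map `α(X) ↦ α(X)_a` from matrices over `R[X]` to matrices over `R_a[X]` induced by the
localisation map `R → R_a`. -/
noncomputable def localize {m : ℕ} {R : Type*} [CommRing R] (a : R) :
    GL (Fin m) (Polynomial R) →* GL (Fin m) (Polynomial (Localization.Away a)) :=
  Matrix.GeneralLinearGroup.map
    (Polynomial.mapRingHom (algebraMap R (Localization.Away a)))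

end RelOrthogonal

/-!
The dilation principle is proved first in the absolute case, for a ring homomorphism `φ : R → S`
and an element `a` of `R` such that every element of `S` becomes an element of the image of `φ`
after multiplication by a power of `φ a`; the relative case is then deduced by passing to the double
`R ×_{R/I} R`.

*Conjugation.* For fixed `γ ∈ EO_{2n}(S)` and `m`, one has
`γ EO_{2n}(a^N R) γ⁻¹ ⊆ EO_{2n}(a^m R)` for large `N`, where images in `GL_{2n}(S)` are meant
(`exists_conj_mem_imageEO`). It is enough to take `γ = oe_{kl}(c)` and to conjugate `oe_{ij}(y)`. The
commutator formulas settle every case in which the two roots are not opposite. If they are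
opposite, `oe_{ij}(uv)` is written as the commutator of `oe_{ip}(u)` and `oe_{pj}(v)` with a further
index `p`, which exists because `n ≥ 3`.

*Absolute case.* Let `α = ∏ oe(f_k)` be in `EO_{2n}(S[X])`. Then `α(bX) α(0)⁻¹` is a product of
conjugates of the matrices `oe(f_k(bX) - f_k(0))` by constant elementary matrices. If `b` is
divisible by a high power of `a`, then so is `f_k(bX) - f_k(0)`, within the image of `R[X]`, and the
conjugates are images of elementary matrices over `R[X]` (`exists_dilate_mul_inv_mem`).

*Relative case.* An element `α` of `EO_{2n}(R_a[X], I_a[X])` gives the element `(1, α)` of `EO_{2n}`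
over the polynomial ring of the double of `R_a` along `I_a` (`exists_lift_of_mem_relEO`). The
absolute case provides a lift `(β₁, β₂)` of `(1, α(bX))` to an elementary matrix over the polynomial
ring of the double of `R` along `I`. Since `β₁` and `β₂` are words in elementary matrices with
entries congruent modulo `I[X]`, the matrix `β₂ β₁⁻¹` is in `EO_{2n}(R[X], I[X])`
(`map_mul_inv_map_mem_relEO`), and it maps to `α(bX)`.
-/

namespace RelOrthogonal

open Matrix Polynomial

variable {n : ℕ} {R S : Type*} [CommRing R] [CommRing S]

/-! ### Relations between elementary orthogonal matrices -/

theorem sigma_inj {i j : Fin (2 * n)} : sigma i = sigma j ↔ i = j :=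
  ⟨fun h => by rw [← sigma_sigma i, h, sigma_sigma], fun h => h ▸ rfl⟩

@[simp] theorem coe_oe {i j : Fin (2 * n)} (hij : i ≠ j) (hσ : i ≠ sigma j) (z : R) :
    (oe i j hij hσ z : Matrix (Fin (2 * n)) (Fin (2 * n)) R) = oeMatrix i j z := rfl

theorem oe_mul_oe {i j : Fin (2 * n)} (hij : i ≠ j) (hσ : i ≠ sigma j) (z w : R) :
    oe i j hij hσ z * oe i j hij hσ w = oe i j hij hσ (z + w) :=
  Units.ext (oeMatrix_mul hij hσ z w)

theorem oe_zero {i j : Fin (2 * n)} (hij : i ≠ j) (hσ : i ≠ sigma j) :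
    oe i j hij hσ (0 : R) = 1 :=
  Units.ext (oeMatrix_zero i j)

theorem inv_oe {i j : Fin (2 * n)} (hij : i ≠ j) (hσ : i ≠ sigma j) (z : R) :
    (oe i j hij hσ z)⁻¹ = oe i j hij hσ (-z) :=
  inv_eq_of_mul_eq_one_right (by rw [oe_mul_oe, add_neg_cancel, oe_zero])

/-- Each root is written by two pairs of indices; this symmetry halves the case distinctions. -/
theorem oe_eq_oe_sigma {i j : Fin (2 * n)} (hij : i ≠ j) (hσ : i ≠ sigma j) (z : R) :
    oe i j hij hσ z = oe (sigma j) (sigma i) (fun h => hij (sigma_inj.1 h).symm)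
      (fun h => hσ (by rw [h, sigma_sigma])) (-z) := by
  apply Units.ext
  have hneg (p q : Fin (2 * n)) : Matrix.single p q (-z) = -Matrix.single p q z := by
    ext k l
    by_cases h : p = k ∧ q = l <;> simp [h]
  simp only [coe_oe, oeMatrix, sigma_sigma, hneg]
  abel

theorem map_oe (f : R →+* S) {i j : Fin (2 * n)} (hij : i ≠ j) (hσ : i ≠ sigma j) (z : R) :
    GeneralLinearGroup.map f (oe i j hij hσ z) = oe i j hij hσ (f z) := by
  apply Units.ext
  change (oeMatrix i j z).map f = oeMatrix i j (f z)
  ext k l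
  simp [oeMatrix, Matrix.single_apply, Matrix.one_apply, apply_ite f]

/-- The commutator formula `[oe_{ki}(c), oe_{ij}(y)] = oe_{kj}(cy)` for indices in three different
pairs `{i, σ i}`. -/
theorem oe_mul_oe_of_sigma_ne {i j k : Fin (2 * n)} (hki : k ≠ i) (hki' : k ≠ sigma i)
    (hij : i ≠ j) (hij' : i ≠ sigma j) (hkj : k ≠ j) (hkj' : k ≠ sigma j) (c y : R) :
    oe k i hki hki' c * oe i j hij hij' y =
      oe k j hkj hkj' (c * y) * oe i j hij hij' y * oe k i hki hki' c := by
  apply Units.ext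
  have h2 := sigma_ne j
  have h3 := sigma_ne k
  have h4 : sigma i ≠ k := fun h => hki' h.symm
  have h5 : sigma j ≠ i := fun h => hij' h.symm
  have h7 : j ≠ sigma i := fun h => h5 (by rw [h, sigma_sigma])
  have h8 : i ≠ sigma k := fun h => h4 (by rw [h, sigma_sigma])
  simp [oeMatrix, mul_add, add_mul, mul_sub, sub_mul, single_mul_single_of_ne, sigma_inj,
    h3, h4, h7, h2.symm, h8.symm, hki, hkj, hij.symm, hkj.symm, hij', mul_comm y c]
  abel

/-- The sum of the roots of `oe_{σ(j) i}` and `oe_{ij}` is twice a weight of the standard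
representation, hence not a root. The cross terms do not vanish, but both products have the same
`(σ(j), j)` entry. -/
theorem oe_commute_of_eq_sigma {i j : Fin (2 * n)} (hij : i ≠ j) (hij' : i ≠ sigma j)
    (h₁ : sigma j ≠ i) (h₂ : sigma j ≠ sigma i) (c y : R) :
    oe (sigma j) i h₁ h₂ c * oe i j hij hij' y = oe i j hij hij' y * oe (sigma j) i h₁ h₂ c := by
  apply Units.ext
  have h4 := sigma_ne j
  have h7 : j ≠ sigma i := fun h => h₁ (by rw [h, sigma_sigma])
  simp [oeMatrix, mul_add, add_mul, mul_sub, sub_mul, single_mul_single_of_ne, sigma_inj,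
    sigma_sigma, h7, h4.symm, hij, hij.symm, hij', mul_comm y c]
  abel

/-- If neither of the two matrix units in one matrix is composable with one of the other, there
are no cross terms. -/
theorem oe_commute {i j k l : Fin (2 * n)} (hij : i ≠ j) (hij' : i ≠ sigma j)
    (hkl : k ≠ l) (hkl' : k ≠ sigma l) (h₁ : l ≠ i) (h₂ : k ≠ j) (h₃ : l ≠ sigma j)
    (h₄ : k ≠ sigma i) (c y : R) :
    oe k l hkl hkl' c * oe i j hij hij' y = oe i j hij hij' y * oe k l hkl hkl' c := by
  apply Units.ext
  have h5 : i ≠ sigma k := fun h => h₄ (by rw [h, sigma_sigma])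
  have h6 : j ≠ sigma l := fun h => h₃ (by rw [h, sigma_sigma])
  simp [oeMatrix, mul_add, add_mul, mul_sub, sub_mul, single_mul_single_of_ne, sigma_inj,
    h₁, h₂, h₃, h6, h₁.symm, h₂.symm, h₄.symm, h5.symm]
  abel

/-! ### Elementary groups and their images -/

theorem oe_mem_EO {i j : Fin (2 * n)} (hij : i ≠ j) (hσ : i ≠ sigma j) (z : R) :
    oe i j hij hσ z ∈ EO n R :=
  Subgroup.subset_closure ⟨i, j, hij, hσ, z, rfl⟩

/-- As the inverse of `oe_{ij}(z)` is again elementary, inverses need no separate treatment. -/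
@[elab_as_elim]
theorem EO_induction {p : (g : GL (Fin (2 * n)) R) → g ∈ EO n R → Prop} (one : p 1 (one_mem _))
    (mul_oe : ∀ g hg (i j : Fin (2 * n)) (hij : i ≠ j) (hσ : i ≠ sigma j) (z : R), p g hg →
      p (g * oe i j hij hσ z) (mul_mem hg (oe_mem_EO hij hσ z)))
    {g : GL (Fin (2 * n)) R} (hg : g ∈ EO n R) : p g hg := by
  induction hg using Subgroup.closure_induction_right with
  | one => exact one
  | mul_right g hg x hx ih =>
    obtain ⟨i, j, hij, hσ, z, rfl⟩ := hx
    exact mul_oe g hg i j hij hσ z ih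
  | mul_inv_cancel g hg x hx ih =>
    obtain ⟨i, j, hij, hσ, z, rfl⟩ := hx
    simpa only [inv_oe] using mul_oe g hg i j hij hσ (-z) ih

theorem oe_mem_EOIdeal {I : Ideal R} {i j : Fin (2 * n)} (hij : i ≠ j) (hσ : i ≠ sigma j) {z : R}
    (hz : z ∈ I) : oe i j hij hσ z ∈ EOIdeal n I :=
  Subgroup.subset_closure ⟨i, j, hij, hσ, z, hz, rfl⟩

theorem map_mem_EO (f : R →+* S) {g : GL (Fin (2 * n)) R} (hg : g ∈ EO n R) :
    GeneralLinearGroup.map f g ∈ EO n S := by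
  suffices h : EO n R ≤ (EO n S).comap (GeneralLinearGroup.map f) from h hg
  refine (Subgroup.closure_le _).2 ?_
  rintro _ ⟨i, j, hij, hσ, z, rfl⟩
  simpa only [SetLike.mem_coe, Subgroup.mem_comap, map_oe] using oe_mem_EO hij hσ (f z)

/-- The image in `GL_{2n}(S)` of the group `EO_{2n}(a^m R)` under a ring homomorphism `R → S`. -/
def imageEO (n : ℕ) (φ : R →+* S) (a : R) (m : ℕ) : Subgroup (GL (Fin (2 * n)) S) :=
  (EOIdeal n (Ideal.span {a ^ m})).map (GeneralLinearGroup.map φ)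

theorem oe_mem_imageEO (φ : R →+* S) {a : R} {m : ℕ} {i j : Fin (2 * n)} (hij : i ≠ j)
    (hσ : i ≠ sigma j) {y : R} (hy : y ∈ Ideal.span {a ^ m}) :
    oe i j hij hσ (φ y) ∈ imageEO n φ a m :=
  ⟨_, oe_mem_EOIdeal hij hσ hy, map_oe φ hij hσ y⟩

theorem span_pow_le_span_pow (a : R) {k m : ℕ} (h : k ≤ m) :
    Ideal.span {a ^ m} ≤ Ideal.span {a ^ k} :=
  Ideal.span_singleton_le_span_singleton.2 (pow_dvd_pow a h)

/-! ### Conjugation of `EO_{2n}(a^N R)` by elementary matrices over `S` -/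

section Conjugation

variable {φ : R →+* S} {a : R} {c : S} {r : ℕ}

/-- Conjugation by `oe_{kl}(c)` when the root of `oe_{ij}` starts where that of `oe_{kl}` ends
and the two are not opposite: the sum of the roots is either a root or no root at all. -/
theorem conj_mem_imageEO_of_eq (hc : φ a ^ r * c ∈ φ.range) {i j k l : Fin (2 * n)}
    (hij : i ≠ j) (hij' : i ≠ sigma j) (hkl : k ≠ l) (hkl' : k ≠ sigma l)
    (hli : l = i) (hkj : k ≠ j) {m : ℕ} {y : R} (hy : y ∈ Ideal.span {a ^ (m + r)}) :
    oe k l hkl hkl' c * oe i j hij hij' (φ y) * (oe k l hkl hkl' c)⁻¹ ∈ imageEO n φ a m := by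
  have hy' := span_pow_le_span_pow a (Nat.le_add_right m r) hy
  subst hli
  by_cases hkj' : k = sigma j
  · subst hkj'
    rw [oe_commute_of_eq_sigma, mul_inv_cancel_right]
    exact oe_mem_imageEO φ hij hij' hy'
  · rw [oe_mul_oe_of_sigma_ne hkl hkl' hij hij' hkj hkj', mul_inv_cancel_right]
    refine mul_mem ?_ (oe_mem_imageEO φ hij hij' hy')
    obtain ⟨x, rfl⟩ := Ideal.mem_span_singleton'.1 hy
    obtain ⟨d, hd⟩ := hc
    have h : c * φ (x * a ^ (m + r)) = φ (x * d * a ^ m) := by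
      simp only [map_mul, map_pow, pow_add, hd]
      ring
    rw [h]
    exact oe_mem_imageEO φ hkj hkj' (Ideal.mul_mem_left _ _ (Ideal.mem_span_singleton_self _))

/-- Conjugation by `oe_{kl}(c)` of an elementary matrix for a root that is not opposite to the
root of `oe_{kl}` loses only the denominator of `c`. -/
theorem conj_mem_imageEO_of_not_opposite (hc : φ a ^ r * c ∈ φ.range) {i j k l : Fin (2 * n)}
    (hij : i ≠ j) (hij' : i ≠ sigma j) (hkl : k ≠ l) (hkl' : k ≠ sigma l)
    (h₁ : ¬ (k = j ∧ l = i)) (h₂ : ¬ (k = sigma i ∧ l = sigma j)) {m : ℕ} {y : R}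
    (hy : y ∈ Ideal.span {a ^ (m + r)}) :
    oe k l hkl hkl' c * oe i j hij hij' (φ y) * (oe k l hkl hkl' c)⁻¹ ∈ imageEO n φ a m := by
  have hc' : φ a ^ r * -c ∈ φ.range := by simpa using neg_mem hc
  have hy' : -y ∈ Ideal.span {a ^ (m + r)} := neg_mem hy
  by_cases h₃ : l = i
  · exact conj_mem_imageEO_of_eq hc hij hij' hkl hkl' h₃ (fun h => h₁ ⟨h, h₃⟩) hy
  by_cases h₄ : k = j
  · rw [oe_eq_oe_sigma hkl, oe_eq_oe_sigma hij, ← map_neg]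
    exact conj_mem_imageEO_of_eq hc' _ _ _ _ (by rw [h₄]) (by rwa [Ne, sigma_inj]) hy'
  by_cases h₅ : l = sigma j
  · rw [oe_eq_oe_sigma hij, ← map_neg]
    exact conj_mem_imageEO_of_eq hc _ _ hkl hkl' h₅ (fun h => h₂ ⟨h, h₅⟩) hy'
  by_cases h₆ : k = sigma i
  · rw [oe_eq_oe_sigma hkl]
    refine conj_mem_imageEO_of_eq hc' hij hij' _ _ (by rw [h₆, sigma_sigma]) (fun h => ?_) hy
    exact h₅ (by rw [← h, sigma_sigma])
  rw [oe_commute hij hij' hkl hkl' h₃ h₄ h₅ h₆, mul_inv_cancel_right]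
  exact oe_mem_imageEO φ hij hij' (span_pow_le_span_pow a (Nat.le_add_right m r) hy)

/-- For `n ≥ 3` there is an index outside any two of the pairs `{i, σ i}`. -/
theorem exists_index_ne (hn : 3 ≤ n) (i j : Fin (2 * n)) :
    ∃ p, p ≠ i ∧ p ≠ j ∧ p ≠ sigma i ∧ p ≠ sigma j := by
  by_contra! h
  have hle : (Finset.univ : Finset (Fin (2 * n))) ⊆ {i, j, sigma i, sigma j} := fun p _ => by
    simp only [Finset.mem_insert, Finset.mem_singleton]
    by_contra! hp
    exact hp.2.2.2 (h p hp.1 hp.2.1 hp.2.2.1)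
  have := (Finset.card_le_card hle).trans Finset.card_le_four
  rw [Finset.card_univ, Fintype.card_fin] at this
  omega

/-- Conjugation by `oe_{ji}(c)` of a matrix `oe_{ij}(y)`, the case of opposite roots. Writing
`oe_{ij}(uv)` as the commutator of `oe_{ip}(u)` and `oe_{pj}(v)` replaces it by matrices whose
roots are not opposite to that of `oe_{ji}`; this is where `n ≥ 3` is used. -/
theorem conj_mem_imageEO_of_opposite (hn : 3 ≤ n) (hc : φ a ^ r * c ∈ φ.range)
    {i j k l : Fin (2 * n)}
    (hij : i ≠ j) (hij' : i ≠ sigma j) (hkl : k ≠ l) (hkl' : k ≠ sigma l)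
    (hkj : k = j) (hli : l = i) {m : ℕ} {y : R}
    (hy : y ∈ Ideal.span {a ^ (2 * (m + r))}) :
    oe k l hkl hkl' c * oe i j hij hij' (φ y) * (oe k l hkl hkl' c)⁻¹ ∈ imageEO n φ a m := by
  obtain ⟨p, hpi, hpj, hpi', hpj'⟩ := exists_index_ne hn i j
  obtain ⟨x, rfl⟩ := Ideal.mem_span_singleton'.1 hy
  have hip' : i ≠ sigma p := fun h => hpi' (by rw [h, sigma_sigma])
  have hu : a ^ (m + r) ∈ Ideal.span {a ^ (m + r)} := Ideal.mem_span_singleton_self _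
  have hv : x * a ^ (m + r) ∈ Ideal.span {a ^ (m + r)} := Ideal.mul_mem_left _ _ hu
  have hcomm := oe_mul_oe_of_sigma_ne hpi.symm hip' hpj hpj' hij hij' (φ (a ^ (m + r)))
    (φ (x * a ^ (m + r)))
  rw [← map_mul, show a ^ (m + r) * (x * a ^ (m + r)) = x * a ^ (2 * (m + r)) by ring,
    ← mul_inv_eq_iff_eq_mul, ← mul_inv_eq_iff_eq_mul] at hcomm
  rw [← hcomm]
  suffices h : _ ∈ (imageEO n φ a m).comap (MulAut.conj (oe k l hkl hkl' c)).toMonoidHom by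
    simpa only [Subgroup.mem_comap, MulEquiv.coe_toMonoidHom, MulAut.conj_apply] using h
  have hip : oe i p hpi.symm hip' (φ (a ^ (m + r))) ∈
      (imageEO n φ a m).comap (MulAut.conj (oe k l hkl hkl' c)).toMonoidHom :=
    conj_mem_imageEO_of_not_opposite hc hpi.symm hip' hkl hkl'
      (fun h => hpj (h.1.symm.trans hkj)) (fun h => hij' (hli.symm.trans
        (by rw [← hkj, h.1, sigma_sigma, hli]))) hu
  have hpj : oe p j hpj hpj' (φ (x * a ^ (m + r))) ∈
      (imageEO n φ a m).comap (MulAut.conj (oe k l hkl hkl' c)).toMonoidHom :=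
    conj_mem_imageEO_of_not_opposite hc hpj hpj' hkl hkl'
      (fun h => hpi (h.2.symm.trans hli)) (fun h => hij' (hli.symm.trans h.2)) hv
  exact mul_mem (mul_mem (mul_mem hip hpj) (inv_mem hip)) (inv_mem hpj)

/-- Conjugation by `oe_{kl}(c)` where `c` has denominator `a^r`: the loss in the power of `a` does not
depend on the matrix that is conjugated. -/
theorem conj_oe_mem_imageEO (hn : 3 ≤ n) (hc : φ a ^ r * c ∈ φ.range) {k l : Fin (2 * n)}
    (hkl : k ≠ l) (hkl' : k ≠ sigma l) (m : ℕ) {g : GL (Fin (2 * n)) S}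
    (hg : g ∈ imageEO n φ a (2 * (m + r))) :
    oe k l hkl hkl' c * g * (oe k l hkl hkl' c)⁻¹ ∈ imageEO n φ a m := by
  suffices h : imageEO n φ a (2 * (m + r)) ≤
      (imageEO n φ a m).comap (MulAut.conj (oe k l hkl hkl' c)).toMonoidHom from h hg
  refine Subgroup.map_le_iff_le_comap.2 ((Subgroup.closure_le _).2 ?_)
  rintro _ ⟨i, j, hij, hij', y, hy, rfl⟩
  simp only [SetLike.mem_coe, Subgroup.mem_comap, map_oe, MulEquiv.coe_toMonoidHom,
    MulAut.conj_apply]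
  by_cases h₁ : k = j ∧ l = i
  · exact conj_mem_imageEO_of_opposite hn hc hij hij' hkl hkl' h₁.1 h₁.2 hy
  by_cases h₂ : k = sigma i ∧ l = sigma j
  · rw [oe_eq_oe_sigma hij, ← map_neg]
    exact conj_mem_imageEO_of_opposite hn hc _ _ hkl hkl' h₂.1 h₂.2 (neg_mem hy)
  exact conj_mem_imageEO_of_not_opposite hc hij hij' hkl hkl' h₁ h₂
    (span_pow_le_span_pow a (by omega) hy)

/-- For every `γ ∈ EO_{2n}(S)`, conjugation by `γ` carries the image of `EO_{2n}(a^N R)` into that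
of `EO_{2n}(a^m R)` as soon as `N` is large. -/
theorem exists_conj_mem_imageEO (hn : 3 ≤ n) (hφ : ∀ s, ∃ r : ℕ, φ a ^ r * s ∈ φ.range)
    {γ : GL (Fin (2 * n)) S} (hγ : γ ∈ EO n S) (m : ℕ) :
    ∃ N, ∀ g ∈ imageEO n φ a N, γ * g * γ⁻¹ ∈ imageEO n φ a m := by
  induction hγ using EO_induction generalizing m with
  | one => exact ⟨m, fun g hg => by simpa using hg⟩
  | mul_oe γ _ k l hkl hkl' c ih =>
    obtain ⟨M, hM⟩ := ih m
    obtain ⟨r, hr⟩ := hφ c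
    exact ⟨_, fun g hg => by
      simpa [mul_assoc] using hM _ (conj_oe_mem_imageEO hn hr hkl hkl' M hg)⟩

end Conjugation

/-! ### Evaluation at zero, dilation and constant matrices -/

/-- A constant matrix, regarded as a matrix over `R[X]`. -/
noncomputable def constGL {m : ℕ} {R : Type*} [CommRing R] :
    GL (Fin m) R →* GL (Fin m) R[X] :=
  GeneralLinearGroup.map C

theorem evalZero_constGL {m : ℕ} (g : GL (Fin m) R) : evalZero (constGL g) = g := by
  have h : (evalRingHom (0 : R)).comp C = RingHom.id R := RingHom.ext fun x => by simp
  change GeneralLinearGroup.map ((evalRingHom (0 : R)).comp C) g = g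
  rw [h]
  rfl

theorem evalZero_map {m : ℕ} (φ : R →+* S) (g : GL (Fin m) R[X]) :
    evalZero (GeneralLinearGroup.map (mapRingHom φ) g) =
      GeneralLinearGroup.map φ (evalZero g) := by
  have h : (evalRingHom (0 : S)).comp (mapRingHom φ) = φ.comp (evalRingHom 0) :=
    RingHom.ext fun p => by simp [← coeff_zero_eq_eval_zero]
  change GeneralLinearGroup.map ((evalRingHom (0 : S)).comp (mapRingHom φ)) g = _
  rw [h]
  rfl

theorem evalZero_dilate {m : ℕ} (c : R) (g : GL (Fin m) R[X]) :
    evalZero (dilate c g) = evalZero g := by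
  have h : (evalRingHom (0 : R)).comp (compRingHom (C c * X)) = evalRingHom 0 :=
    RingHom.ext fun p => by simp
  change GeneralLinearGroup.map ((evalRingHom (0 : R)).comp (compRingHom (C c * X))) g = _
  rw [h]
  rfl

theorem map_dilate {m : ℕ} (φ : R →+* S) (c : R) (g : GL (Fin m) R[X]) :
    GeneralLinearGroup.map (mapRingHom φ) (dilate c g) =
      dilate (φ c) (GeneralLinearGroup.map (mapRingHom φ) g) := by
  have h : (mapRingHom φ).comp (compRingHom (C c * X)) =
      (compRingHom (C (φ c) * X)).comp (mapRingHom φ) :=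
    RingHom.ext fun p => by simp [map_comp]
  change GeneralLinearGroup.map ((mapRingHom φ).comp (compRingHom (C c * X))) g = _
  rw [h]
  rfl

theorem map_constGL {m : ℕ} (φ : R →+* S) (g : GL (Fin m) R) :
    GeneralLinearGroup.map (mapRingHom φ) (constGL g) =
      constGL (GeneralLinearGroup.map φ g) := by
  have h : (mapRingHom φ).comp C = C.comp φ := RingHom.ext fun x => by simp
  change GeneralLinearGroup.map ((mapRingHom φ).comp C) g = _
  rw [h]
  rfl

/-! ### The dilation principle in the absolute case -/

section Dilation

variable {φ : R →+* S} {a : R}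

theorem exists_pow_mul_mem_range_mapRingHom (hφ : ∀ s, ∃ r : ℕ, φ a ^ r * s ∈ φ.range)
    (f : S[X]) : ∃ r : ℕ, mapRingHom φ (C a) ^ r * f ∈ (mapRingHom φ).range := by
  induction f using Polynomial.induction_on' with
  | add f g hf hg =>
    obtain ⟨r, hr⟩ := hf
    obtain ⟨t, ht⟩ := hg
    refine ⟨r + t, ?_⟩
    have h := add_mem
      (mul_mem (pow_mem (RingHom.mem_range_self (mapRingHom φ) (C a)) t) hr)
      (mul_mem (pow_mem (RingHom.mem_range_self (mapRingHom φ) (C a)) r) ht)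
    convert h using 1
    ring
  | monomial k s =>
    obtain ⟨r, x, hx⟩ := hφ s
    exact ⟨r, monomial k x, by
      rw [coe_mapRingHom, map_monomial, hx, map_C, ← C_pow, C_mul_monomial]⟩

/-- If `b` is divisible by a high power of `a`, then `f(bX) - f(0)` has coefficients in the image
of `a^N R`. -/
theorem exists_comp_sub_mem_image (hφ : ∀ s, ∃ r : ℕ, φ a ^ r * s ∈ φ.range) (N : ℕ) (f : S[X]) :
    ∃ d : ℕ, ∀ b ∈ Ideal.span {a ^ d}, ∃ g ∈ Ideal.span {(C a : R[X]) ^ N},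
      mapRingHom φ g = f.comp (C (φ b) * X) - C (f.eval 0) := by
  induction f using Polynomial.induction_on' with
  | add f g hf hg =>
    obtain ⟨d, hd⟩ := hf
    obtain ⟨e, he⟩ := hg
    refine ⟨max d e, fun b hb => ?_⟩
    obtain ⟨u, hu, hu'⟩ := hd b (span_pow_le_span_pow a (le_max_left d e) hb)
    obtain ⟨v, hv, hv'⟩ := he b (span_pow_le_span_pow a (le_max_right d e) hb)
    refine ⟨u + v, add_mem hu hv, ?_⟩
    rw [map_add, hu', hv', add_comp, eval_add, C_add]
    ring
  | monomial k s =>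
    rcases k with _ | k
    · exact ⟨0, fun b _ => ⟨0, zero_mem _, by simp⟩⟩
    obtain ⟨r, x, hx⟩ := hφ s
    refine ⟨N + r, fun b hb => ?_⟩
    obtain ⟨t, rfl⟩ := Ideal.mem_span_singleton'.1 hb
    refine ⟨C (x * t * (t * a ^ (N + r)) ^ k) * X ^ (k + 1) * C a ^ N,
      Ideal.mul_mem_left _ _ (Ideal.mem_span_singleton_self _), ?_⟩
    simp only [map_mul, map_pow, coe_mapRingHom, map_C, map_X, hx, monomial_comp, eval_monomial]
    rw [map_zero, zero_pow (Nat.succ_ne_zero k), mul_zero, sub_zero]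
    ring

/-- The dilation principle for `EO_{2n}`, in the form `α(bX) α(0)⁻¹`. If `α = β · oe_{ij}(f)`, then
`α(bX) α(0)⁻¹` is the product of `β(bX) β(0)⁻¹` and of the conjugate of
`oe_{ij}(f(bX) - f(0))` by the constant matrix `β(0)`. -/
theorem exists_dilate_mul_inv_mem (hn : 3 ≤ n) (hφ : ∀ s, ∃ r : ℕ, φ a ^ r * s ∈ φ.range)
    {α : GL (Fin (2 * n)) S[X]} (hα : α ∈ EO n S[X]) :
    ∃ d : ℕ, ∀ b ∈ Ideal.span {a ^ d},
      dilate (φ b) α * (constGL (evalZero α))⁻¹ ∈ imageEO n (mapRingHom φ) (C a) 0 := by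
  induction hα using EO_induction with
  | one => exact ⟨0, fun b _ => by simp⟩
  | mul_oe β hβ i j hij hσ f ih =>
    obtain ⟨d, hd⟩ := ih
    have hβ₀ : constGL (evalZero β) ∈ EO n S[X] := map_mem_EO _ (map_mem_EO _ hβ)
    obtain ⟨N, hN⟩ := exists_conj_mem_imageEO hn (exists_pow_mul_mem_range_mapRingHom hφ) hβ₀ 0
    obtain ⟨e, he⟩ := exists_comp_sub_mem_image hφ N f
    refine ⟨max d e, fun b hb => ?_⟩
    obtain ⟨g, hg, hg'⟩ := he b (span_pow_le_span_pow a (le_max_right d e) hb)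
    have h₁ := hd b (span_pow_le_span_pow a (le_max_left d e) hb)
    have h₂ := hN _ (oe_mem_imageEO (mapRingHom φ) hij hσ hg)
    have h₃ : dilate (φ b) (oe i j hij hσ f) * (constGL (evalZero (oe i j hij hσ f)))⁻¹ =
        oe i j hij hσ (mapRingHom φ g) := by
      simp only [dilate, constGL, evalZero, map_oe, inv_oe, oe_mul_oe, hg', sub_eq_add_neg,
        coe_compRingHom, coe_evalRingHom]
    convert mul_mem h₁ h₂ using 1
    rw [← h₃]
    simp only [map_mul, _root_.mul_inv_rev, mul_assoc, inv_mul_cancel_left]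

/-- The absolute dilation principle. Neither injectivity of `φ` nor invertibility of `φ a` is
needed, only that `φ a` clears denominators. -/
theorem exists_dilate_eq_map (hn : 3 ≤ n) (hφ : ∀ s, ∃ r : ℕ, φ a ^ r * s ∈ φ.range)
    {α : GL (Fin (2 * n)) S[X]} (hα : α ∈ EO n S[X]) (hα₀ : evalZero α = 1) :
    ∃ d : ℕ, ∀ b ∈ Ideal.span {a ^ d}, ∃ β ∈ EO n R[X], evalZero β = 1 ∧
      GeneralLinearGroup.map (mapRingHom φ) β = dilate (φ b) α := by
  obtain ⟨d, hd⟩ := exists_dilate_mul_inv_mem hn hφ hα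
  refine ⟨d, fun b hb => ?_⟩
  obtain ⟨β, hβ, hβα⟩ := hd b hb
  rw [hα₀, map_one, inv_one, mul_one] at hβα
  have hβ' : β ∈ EO n R[X] := EOIdeal_le_EO n _ hβ
  -- `β(0)` becomes trivial over `S`, so `β` can be normalised at `X = 0`.
  have hβ₀ : GeneralLinearGroup.map φ (evalZero β) = 1 := by
    rw [← evalZero_map, hβα, evalZero_dilate, hα₀]
  refine ⟨β * (constGL (evalZero β))⁻¹,
    mul_mem hβ' (inv_mem (map_mem_EO _ (map_mem_EO _ hβ'))), ?_, ?_⟩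
  · rw [map_mul, map_inv, evalZero_constGL, mul_inv_cancel]
  · rw [map_mul, map_inv, map_constGL, hβ₀, map_one, inv_one, mul_one, hβα]

end Dilation

/-! ### Relative elementary groups and pairs of ring homomorphisms -/

section Relative

theorem conj_mem_relEO {I : Ideal R} {g x : GL (Fin (2 * n)) R} (hg : g ∈ EO n R)
    (hx : x ∈ EOIdeal n I) : g * x * g⁻¹ ∈ relEO n I := by
  have hx' : (⟨x, EOIdeal_le_EO n I hx⟩ : EO n R) ∈ Subgroup.normalClosure
      (((EOIdeal n I).subgroupOf (EO n R) : Subgroup (EO n R)) : Set (EO n R)) :=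
    Subgroup.subset_normalClosure hx
  exact ⟨_, Subgroup.normalClosure_normal.conj_mem _ hx' ⟨g, hg⟩, rfl⟩

theorem relEO_le {I : Ideal R} {K : Subgroup (GL (Fin (2 * n)) R)}
    (hK : ∀ g ∈ EO n R, ∀ x ∈ EOIdeal n I, g * x * g⁻¹ ∈ K) : relEO n I ≤ K := by
  refine Subgroup.map_le_iff_le_comap.2 ((Subgroup.closure_le _).2 fun y hy => ?_)
  obtain ⟨x, hx, hxy⟩ := Group.mem_conjugatesOfSet_iff.1 hy
  obtain ⟨g, rfl⟩ := isConj_iff.1 hxy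
  exact hK g g.2 x hx

/-- If two ring homomorphisms are congruent modulo `I`, then so are, modulo `EO_{2n}(R, I)`, the
maps they induce on `EO_{2n}`. -/
theorem map_mul_inv_map_mem_relEO {I : Ideal R} {f g : S →+* R} (h : ∀ x, g x - f x ∈ I)
    {β : GL (Fin (2 * n)) S} (hβ : β ∈ EO n S) :
    GeneralLinearGroup.map g β * (GeneralLinearGroup.map f β)⁻¹ ∈ relEO n I := by
  induction hβ using EO_induction with
  | one => simp
  | mul_oe β hβ i j hij hσ z ih =>
    have h₁ := conj_mem_relEO (map_mem_EO g hβ) (oe_mem_EOIdeal hij hσ (h z))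
    rw [sub_eq_add_neg, ← oe_mul_oe, ← inv_oe] at h₁
    convert mul_mem h₁ ih using 1
    simp only [map_mul, map_oe, _root_.mul_inv_rev, mul_assoc, inv_mul_cancel_left]

/-- If `g` has a section and every pair `(0, x)` with `x ∈ I` lifts along `(f, g)`, then so does
every pair `(1, h)` with `h ∈ EO_{2n}(R, I)`, to an elementary matrix. Conjugating a lift of
`(1, x)` by an arbitrary lift of `γ ∈ EO_{2n}(R)` along `g` keeps it in the kernel of `f`. -/
theorem exists_lift_of_mem_relEO {I : Ideal R} {f g : S →+* R} {δ : R →+* S}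
    (hg : g.comp δ = RingHom.id R)
    (hI : ∀ x ∈ I, ∃ y, f y = 0 ∧ g y = x) {h : GL (Fin (2 * n)) R} (hh : h ∈ relEO n I) :
    ∃ β ∈ EO n S, GeneralLinearGroup.map f β = 1 ∧ GeneralLinearGroup.map g β = h := by
  suffices hK : relEO n I ≤
      (EO n S ⊓ (GeneralLinearGroup.map f).ker).map (GeneralLinearGroup.map g) by
    obtain ⟨β, ⟨hβ, hβf⟩, hβg⟩ := hK hh
    exact ⟨β, hβ, hβf, hβg⟩
  refine relEO_le fun γ hγ x hx => ?_
  have hx' : x ∈ (EO n S ⊓ (GeneralLinearGroup.map f).ker).map (GeneralLinearGroup.map g) := by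
    refine (Subgroup.closure_le _).2 ?_ hx
    rintro _ ⟨i, j, hij, hσ, x, hx, rfl⟩
    obtain ⟨y, hy, rfl⟩ := hI x hx
    refine ⟨oe i j hij hσ y, ⟨oe_mem_EO hij hσ y, ?_⟩, map_oe g hij hσ y⟩
    change GeneralLinearGroup.map f (oe i j hij hσ y) = 1
    rw [map_oe, hy, oe_zero]
  obtain ⟨β, ⟨hβ, hβf⟩, rfl⟩ := hx'
  have hδ : GeneralLinearGroup.map δ γ ∈ EO n S := map_mem_EO δ hγ
  refine Subgroup.mem_map.2 ⟨_, Subgroup.mem_inf.2 ⟨mul_mem (mul_mem hδ hβ) (inv_mem hδ),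
    Subgroup.Normal.conj_mem inferInstance β hβf _⟩, ?_⟩
  have hgγ : GeneralLinearGroup.map g (GeneralLinearGroup.map δ γ) = γ := by
    change GeneralLinearGroup.map (g.comp δ) γ = γ
    rw [hg]
    rfl
  simp only [map_mul, map_inv, hgγ]

end Relative

/-! ### The double of a ring along an ideal -/

section Double

/-- The double `R ×_{R/I} R` of `R` along `I`: the pairs of elements congruent modulo `I`. -/
def double (I : Ideal R) : Subring (R × R) :=
  ((Ideal.Quotient.mk I).comp (RingHom.snd R R)).eqLocus
    ((Ideal.Quotient.mk I).comp (RingHom.fst R R))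

theorem mem_double {I : Ideal R} {x : R × R} : x ∈ double I ↔ x.2 - x.1 ∈ I :=
  Ideal.Quotient.eq

/-- The first projection of the double. -/
def doubleFst (I : Ideal R) : double I →+* R :=
  (RingHom.fst R R).comp (double I).subtype

/-- The second projection of the double. -/
def doubleSnd (I : Ideal R) : double I →+* R :=
  (RingHom.snd R R).comp (double I).subtype

/-- The diagonal embedding of `R` in its double. -/
def doubleDiag (I : Ideal R) : R →+* double I :=
  ((RingHom.id R).prod (RingHom.id R)).codRestrict (double I) fun x => by simp [mem_double]

/-- The map which a ring homomorphism `R → S` induces from the double along `I` to the double along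
the extension `IS`. -/
def doubleMap (φ : R →+* S) (I : Ideal R) : double I →+* double (I.map φ) :=
  (φ.prodMap φ).restrict (double I) (double (I.map φ)) fun x hx => by
    simpa [mem_double] using Ideal.mem_map_of_mem φ (mem_double.1 hx)

/-- The double of `R_a` along `I_a` is obtained from that of `R` along `I` by inverting `(a, a)`; only
the clearing of denominators is recorded. -/
theorem exists_pow_mul_mem_range_doubleMap [Algebra R S] (a : R) [IsLocalization.Away a S]
    (I : Ideal R) (s : double (I.map (algebraMap R S))) :
    ∃ r : ℕ, doubleMap (algebraMap R S) I (doubleDiag I a) ^ r * s ∈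
      (doubleMap (algebraMap R S) I).range := by
  obtain ⟨⟨s, t⟩, hst⟩ := s
  rw [mem_double, IsLocalization.mem_map_algebraMap_iff (Submonoid.powers a)] at hst
  obtain ⟨⟨⟨x, hx⟩, ⟨_, k, rfl⟩⟩, hxk⟩ := hst
  obtain ⟨m, y, hy⟩ := IsLocalization.Away.surj a s
  simp only [map_pow] at hxk hy
  refine ⟨k + m, ⟨(a ^ k * y, a ^ k * y + a ^ m * x), ?_⟩, ?_⟩
  · simpa [mem_double] using I.mul_mem_left _ hx
  · have h : algebraMap R S a ^ m * t * algebraMap R S a ^ k =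
        algebraMap R S a ^ k * algebraMap R S y + algebraMap R S a ^ m * algebraMap R S x := by
      rw [← hxk, ← hy]
      ring
    refine Subtype.ext (Prod.ext ?_ ?_)
    · change algebraMap R S (a ^ k * y) = algebraMap R S a ^ (k + m) * s
      rw [map_mul, map_pow, ← hy]
      ring
    · change algebraMap R S (a ^ k * y + a ^ m * x) = algebraMap R S a ^ (k + m) * t
      simp only [map_add, map_mul, map_pow, ← h]
      ring

theorem mapRingHom_snd_sub_fst_mem (I : Ideal R) (p : (double I)[X]) :
    mapRingHom (doubleSnd I) p - mapRingHom (doubleFst I) p ∈ polyIdeal I := by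
  rw [polyIdeal, Ideal.mem_map_C_iff]
  intro k
  simpa only [coeff_sub, coe_mapRingHom, coeff_map] using! mem_double.1 (p.coeff k).2

theorem exists_mapRingHom_eq_of_mem_polyIdeal {I : Ideal R} {p : R[X]} (hp : p ∈ polyIdeal I) :
    ∃ q : (double I)[X], mapRingHom (doubleFst I) q = 0 ∧ mapRingHom (doubleSnd I) q = p := by
  rw [polyIdeal, Ideal.mem_map_C_iff] at hp
  let x (k : ℕ) : double I := ⟨(0, p.coeff k), by simpa [mem_double] using hp k⟩
  have h₁ (k) : doubleFst I (x k) = 0 := rfl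
  have h₂ (k) : doubleSnd I (x k) = p.coeff k := rfl
  refine ⟨∑ k ∈ p.support, monomial k (x k), ?_, ?_⟩
  · simp [h₁]
  · simpa [Polynomial.map_sum, h₂] using p.as_sum_support.symm

theorem eq_of_map_doubleFst_of_map_doubleSnd {I : Ideal R} {m : ℕ} {g h : GL (Fin m) (double I)}
    (h₁ : GeneralLinearGroup.map (doubleFst I) g = GeneralLinearGroup.map (doubleFst I) h)
    (h₂ : GeneralLinearGroup.map (doubleSnd I) g = GeneralLinearGroup.map (doubleSnd I) h) :
    g = h :=
  Units.ext <| Matrix.ext fun k l => Subtype.ext <| Prod.ext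
    (congrArg (fun u : GL (Fin m) R => u k l) h₁) (congrArg (fun u : GL (Fin m) R => u k l) h₂)

end Double

end RelOrthogonal

open RelOrthogonal Matrix Polynomial in
theorem mainTheorem3 {R : Type*} [CommRing R] (I : Ideal R) (n : ℕ) (hn : 3 ≤ n)
    (a : R) (ha : ¬ IsNilpotent a)
    (α : Matrix.GeneralLinearGroup (Fin (2 * n)) (Polynomial (Localization.Away a)))
    (hα : α ∈ RelOrthogonal.relEO n
      (RelOrthogonal.polyIdeal (I.map (algebraMap R (Localization.Away a)))))
    (hα0 : RelOrthogonal.evalZero α = 1) :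
    ∃ d₀ : ℕ, ∀ d : ℕ, d₀ ≤ d → ∀ b ∈ Ideal.span {a ^ d},
      ∃ αs ∈ RelOrthogonal.relEO n (RelOrthogonal.polyIdeal I),
        RelOrthogonal.evalZero αs = 1 ∧
        RelOrthogonal.localize a αs =
          RelOrthogonal.dilate (algebraMap R (Localization.Away a) b) α := by
  set φ := algebraMap R (Localization.Away a)
  have hdiag : (mapRingHom (doubleSnd (I.map φ))).comp (mapRingHom (doubleDiag (I.map φ))) =
      RingHom.id _ := by
    rw [mapRingHom_comp]
    exact mapRingHom_id
  -- `A` is the matrix `(1, α)` over the polynomial ring of the double of `R_a`.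
  obtain ⟨A, hA, hA₁, hA₂⟩ := exists_lift_of_mem_relEO hdiag
    (fun p hp => exists_mapRingHom_eq_of_mem_polyIdeal hp) hα
  -- The two components of `A(0)` are `1` and `α(0) = 1`.
  have hA₀ : evalZero A = 1 := by
    have h₁ := evalZero_map (doubleFst (I.map φ)) A
    have h₂ := evalZero_map (doubleSnd (I.map φ)) A
    rw [hA₁, map_one] at h₁
    rw [hA₂, hα0] at h₂
    exact eq_of_map_doubleFst_of_map_doubleSnd (by rw [← h₁, map_one]) (by rw [← h₂, map_one])
  obtain ⟨d₀, hd₀⟩ := exists_dilate_eq_map hn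
    (exists_pow_mul_mem_range_doubleMap (S := Localization.Away a) a I) hA hA₀
  refine ⟨d₀, fun d hd b hb => ?_⟩
  have hb' : doubleDiag I b ∈ Ideal.span {doubleDiag I a ^ d₀} := by
    have := Ideal.mem_map_of_mem (doubleDiag I) (span_pow_le_span_pow a hd hb)
    rwa [Ideal.map_span, Set.image_singleton, map_pow] at this
  obtain ⟨β, hβ, hβ₀, hβA⟩ := hd₀ _ hb'
  have hfst : localize a (GeneralLinearGroup.map (mapRingHom (doubleFst I)) β) = 1 := by
    calc _ = GeneralLinearGroup.map (mapRingHom (doubleFst (I.map φ)))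
          (GeneralLinearGroup.map (mapRingHom (doubleMap φ I)) β) := by
            change GeneralLinearGroup.map ((mapRingHom φ).comp (mapRingHom (doubleFst I))) β =
              GeneralLinearGroup.map ((mapRingHom (doubleFst (I.map φ))).comp
                (mapRingHom (doubleMap φ I))) β
            rw [mapRingHom_comp, mapRingHom_comp]
            rfl
      _ = 1 := by rw [hβA, map_dilate, hA₁, map_one]
  have hsnd : localize a (GeneralLinearGroup.map (mapRingHom (doubleSnd I)) β) =
      dilate (φ b) α := by
    calc _ = GeneralLinearGroup.map (mapRingHom (doubleSnd (I.map φ)))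
          (GeneralLinearGroup.map (mapRingHom (doubleMap φ I)) β) := by
            change GeneralLinearGroup.map ((mapRingHom φ).comp (mapRingHom (doubleSnd I))) β =
              GeneralLinearGroup.map ((mapRingHom (doubleSnd (I.map φ))).comp
                (mapRingHom (doubleMap φ I))) β
            rw [mapRingHom_comp, mapRingHom_comp]
            rfl
      _ = dilate (φ b) α := by
            rw [hβA, map_dilate, hA₂]
            rfl
  -- The components of `β` are `β₁` over `1` and `β₂` over `α(bX)`; the lift is `β₂ β₁⁻¹`.
  refine ⟨_, map_mul_inv_map_mem_relEO (mapRingHom_snd_sub_fst_mem I) hβ, ?_, ?_⟩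
  · rw [map_mul, map_inv, evalZero_map, evalZero_map, hβ₀, map_one, map_one, inv_one, mul_one]
  · rw [map_mul, map_inv, hfst, hsnd, inv_one, mul_one]
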